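/- **Definitions.** Let $R$ be a monoid with group of units $W$ and set of idempotents $E(R)$. $R$ is *factorizable* if $R=E(R)W=WE(R)$ and idempotents commute, so that $E(R)$ is a meet semilattice for $e\le f\Leftrightarrow ef=fe=e$, with meet $ef$. A *generalized Renner-Coxeter system* $(R,\Lambda,S)$ consists of a factorizable monoid $R$ with group of units $W$, a set $S\subseteq W$ and a set $\Lambda\subseteq E(R)$ such that: $(W,S)$ is a Coxeter system; $\Lambda$ is closed under products and is a transversal of $E(R)$ for the conjugation action of $W$; for all $e\le e'$ in $E(R)$ there are $w\in W$ and $f\le f'$ in $\Lambda$ with $wew^{-1}=f$ and $we'w^{-1}=f'$; if $e\le f$ in $\Lambda$, then $\lambda^*(e)\subseteq\lambda^*(f)$, where $\lambda^*(e)=\{s\in S: se=es\ne e\}$; and for every $e\in\Lambda$ the groups $\{w\in W: we=ew\}$ and $\{w\in W: we=ew=e\}$ are standard parabolic subgroups, that is, of the form $W_I=\langle I\rangle$ with $I\subseteq S$. For an idempotent $e$ put also $\lambda(e)=\{s\in S: se=es\}$ and $\lambda_*(e)=\{s\in S: se=es=e\}$; for $e\in\Lambda$ the two groups above are $W_{\lambda(e)}$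 and $W_{\lambda_*(e)}$. Let $\le$ be the Bruhat order on $W$. For $I,J\subseteq S$ let ${}^IW^J=\{u\in W: u\le v \text{ for all } v\in W_IuW_J\}$, let ${}^Iw^J$ be the minimum of $W_IwW_J$, and let ${}^IX^J=\{{}^Ix^J:x\in X\}$ for $X\subseteq W$; an empty index is omitted. Write $r\,\mathcal J\,s$ if $RrR=RsR$. If $R$ is finite, let $w_0$ be the longest element of $W$ and $\Lambda^-=w_0\Lambda w_0$. **Theorem.** Let $(R,\Lambda,S)$ be a generalized Renner-Coxeter system with $R$ finite, and let $r\in R$. There exists a unique tuple $(\sigma_-,e_-,\sigma_0,e_+,\sigma_+)$ with $\sigma_-,\sigma_0,\sigma_+\in W$ and $e_-,e_+\in R$ such that 1. $r=\sigma_-e_-\sigma_0e_+\sigma_+$; 2. $e_+\in\Lambda$, $e_-\in\Lambda^-$ and $e_-\,\mathcal J\,r\,\mathcal J\,e_+$; 3. $\sigma_+\in{}^{\lambda(e_+)}W$ and $\sigma_-\in W^{\lambda(e_-)}$; 4. $\sigma_0\in{}^{\lambda_*(e_-)}\bigl(W_{\lambda(e_-)}w_0W_{\lambda(e_+)}\bigr)^{\lambda_*(e_+)}$.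 Moreover, whenever $e_-,e_+$ satisfy 2, the set in 4 equals $W_{\lambda^*(e_-)}\bigl({}^{\lambda_*(e_-)}w_0^{\lambda_*(e_+)}\bigr)W_{\lambda^*(e_+)}$. -/

import Mathlib

open scoped Pointwise

namespace RennerCoxeter

section Coxeter

variable {B W : Type*} [Group W] {M : CoxeterMatrix B} (cs : CoxeterSystem M W)

/-- The Bruhat order: some reduced word of `v` has a subword that is a reduced word of `u`. -/
def BruhatLE (u v : W) : Prop :=
  ∃ ω ω' : List B, cs.IsReduced ω ∧ cs.wordProd ω = v ∧
    cs.IsReduced ω' ∧ cs.wordProd ω' = u ∧ ω'.Sublist ω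

/-- The standard parabolic subgroup `W_I`. -/
def parabolic (I : Set B) : Subgroup W := Subgroup.closure (cs.simple '' I)

/-- The double coset `W_I w W_J`. -/
def doubleCoset (I J : Set B) (w : W) : Set W :=
  DoubleCoset.doubleCoset w (parabolic cs I : Set W) (parabolic cs J : Set W)

/-- The set `^I W^J` of minimum double coset representatives. The sets `^I W` and `W^J` are the
cases `J = ∅` and `I = ∅`. -/
def minReps (I J : Set B) : Set W :=
  {u | ∀ v ∈ doubleCoset cs I J u, BruhatLE cs u v}

/-- The set `^I X^J = {^I x^J | x ∈ X}` of the minimum elements of the double cosets `W_I x W_J`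
with `x ∈ X`. For `X = {w}` it consists of the single element `^I w^J`. -/
def minRepsOf (I J : Set B) (X : Set W) : Set W :=
  {u | u ∈ minReps cs I J ∧ ∃ x ∈ X, u ∈ doubleCoset cs I J x}

/-- The longest element `w₀` of a finite Coxeter group. -/
noncomputable def longestElement [Finite W] : W :=
  (Finite.exists_max cs.length).choose

theorem length_le_longestElement [Finite W] (w : W) :
    cs.length w ≤ cs.length (longestElement cs) :=
  (Finite.exists_max cs.length).choose_spec w

end Coxeter

section Monoid

variable {R : Type*} [Monoid R]

/-- The natural partial order on idempotents. -/
def IdemLE (e f : R) : Prop := e * f = e ∧ f * e = e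

/-- Green's relation `J`: equality of the two-sided principal ideals `R r R` and `R s R`. -/
def GreenJ (r s : R) : Prop :=
  {x : R | ∃ a b : R, x = a * r * b} = {x : R | ∃ a b : R, x = a * s * b}

variable (R) in
/-- A factorizable monoid: `R = E(R) W = W E(R)` with `W` the group of units, and the set `E(R)` of
idempotents is a meet semilattice under the product, that is, idempotents commute. -/
structure IsFactorizable : Prop where
  exists_idem_mul_unit : ∀ r : R, ∃ (e : R) (w : Rˣ), IsIdempotentElem e ∧ r = e * w
  exists_unit_mul_idem : ∀ r : R, ∃ (w : Rˣ) (e : R), IsIdempotentElem e ∧ r = w * e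
  idem_commute : ∀ e f : R, IsIdempotentElem e → IsIdempotentElem f → e * f = f * e

/-- In a factorizable monoid the product of two idempotents is their meet in the natural order. -/
theorem IsFactorizable.mul_isMeet (h : IsFactorizable R) {e f : R} (he : IsIdempotentElem e)
    (hf : IsIdempotentElem f) :
    IsIdempotentElem (e * f) ∧ IdemLE (e * f) e ∧ IdemLE (e * f) f ∧
      ∀ g : R, IdemLE g e → IdemLE g f → IdemLE g (e * f) := by
  have hc : Commute e f := h.idem_commute e f he hf
  have he' : e * e = e := he
  have hf' : f * f = f := hf
  refine ⟨he.mul_of_commute hc hf, ⟨?_, ?_⟩, ⟨?_, ?_⟩, ?_⟩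
  · rw [mul_assoc, ← hc.eq, ← mul_assoc, he']
  · rw [← mul_assoc, he']
  · rw [mul_assoc, hf']
  · rw [← mul_assoc, ← hc.eq, mul_assoc, hf']
  · rintro g ⟨h1, h2⟩ ⟨h3, h4⟩
    exact ⟨by rw [← mul_assoc, h1, h3], by rw [mul_assoc, h4, h2]⟩

variable {B : Type*} {M : CoxeterMatrix B} (cs : CoxeterSystem M Rˣ)

/-- The type map `λ`, as a set of indices of simple reflections. -/
def typeMap (e : R) : Set B := {i | (cs.simple i : R) * e = e * cs.simple i}

/-- The lower type map `λ_*`. -/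
def lowerTypeMap (e : R) : Set B :=
  {i | (cs.simple i : R) * e = e * cs.simple i ∧ e * cs.simple i = e}

/-- The upper type map `λ^*`. -/
def upperTypeMap (e : R) : Set B :=
  {i | (cs.simple i : R) * e = e * cs.simple i ∧ e * cs.simple i ≠ e}

/-- `(R, Λ, S)` is a generalized Renner-Coxeter system, where the group of units `W = Rˣ` carries
the Coxeter system `cs` and `S` is its set of simple reflections. -/
structure IsRennerCoxeterSystem (Λ : Set R) : Prop where
  factorizable : IsFactorizable R
  isIdempotentElem : ∀ e ∈ Λ, IsIdempotentElem e
  transversal : ∀ e : R, IsIdempotentElem e →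
    ∃! f : R, f ∈ Λ ∧ ∃ w : Rˣ, (w : R) * e * (w⁻¹ : Rˣ) = f
  mul_mem : ∀ e ∈ Λ, ∀ f ∈ Λ, e * f ∈ Λ
  exists_conj_pair : ∀ e e' : R, IsIdempotentElem e → IsIdempotentElem e' → IdemLE e e' →
    ∃ w : Rˣ, ∃ f ∈ Λ, ∃ f' ∈ Λ, IdemLE f f' ∧
      (w : R) * e * (w⁻¹ : Rˣ) = f ∧ (w : R) * e' * (w⁻¹ : Rˣ) = f'
  upperTypeMap_mono : ∀ e ∈ Λ, ∀ f ∈ Λ, IdemLE e f → upperTypeMap cs e ⊆ upperTypeMap cs f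
  centralizer_parabolic : ∀ e ∈ Λ, ∃ I : Set B,
    {w : Rˣ | (w : R) * e = e * w} = (parabolic cs I : Set Rˣ)
  fixer_parabolic : ∀ e ∈ Λ, ∃ I : Set B,
    {w : Rˣ | (w : R) * e = e * w ∧ e * w = e} = (parabolic cs I : Set Rˣ)

/-- The type map is the one determined by `W_{λ(e)} = {w | we = ew}`. -/
theorem IsRennerCoxeterSystem.parabolic_typeMap {Λ : Set R} (h : IsRennerCoxeterSystem cs Λ)
    {e : R} (he : e ∈ Λ) :
    (parabolic cs (typeMap cs e) : Set Rˣ) = {w : Rˣ | (w : R) * e = e * w} := by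
  obtain ⟨I, hI⟩ := h.centralizer_parabolic e he
  rw [hI]
  apply Set.Subset.antisymm
  · refine SetLike.coe_subset_coe.2 ((Subgroup.closure_le _).2 ?_)
    rw [← hI]
    rintro _ ⟨i, hi, rfl⟩
    exact hi
  · refine SetLike.coe_subset_coe.2 (Subgroup.closure_mono (Set.image_mono fun i hi => ?_))
    have : cs.simple i ∈ (parabolic cs I : Set Rˣ) :=
      Subgroup.subset_closure (Set.mem_image_of_mem _ hi)
    rw [← hI] at this
    exact this

/-- The lower type map is the one determined by `W_{λ_*(e)} = {w | we = ew = e}`. -/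
theorem IsRennerCoxeterSystem.parabolic_lowerTypeMap {Λ : Set R}
    (h : IsRennerCoxeterSystem cs Λ) {e : R} (he : e ∈ Λ) :
    (parabolic cs (lowerTypeMap cs e) : Set Rˣ) =
      {w : Rˣ | (w : R) * e = e * w ∧ e * w = e} := by
  obtain ⟨I, hI⟩ := h.fixer_parabolic e he
  rw [hI]
  apply Set.Subset.antisymm
  · refine SetLike.coe_subset_coe.2 ((Subgroup.closure_le _).2 ?_)
    rw [← hI]
    rintro _ ⟨i, hi, rfl⟩
    exact hi
  · refine SetLike.coe_subset_coe.2 (Subgroup.closure_mono (Set.image_mono fun i hi => ?_))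
    have : cs.simple i ∈ (parabolic cs I : Set Rˣ) :=
      Subgroup.subset_closure (Set.mem_image_of_mem _ hi)
    rw [← hI] at this
    exact this

/-- The opposite cross-sectional lattice `Λ⁻ = w₀ Λ w₀`. -/
def oppositeLattice [Finite R] (Λ : Set R) : Set R :=
  {f | ∃ e ∈ Λ, f = ((longestElement cs : Rˣ) : R) * e * (longestElement cs : Rˣ)}

/-- The set `^{λ_*(e₋)}(W_{λ(e₋)} w₀ W_{λ(e₊)})^{λ_*(e₊)}`. -/
def middleSet [Finite R] (em ep : R) : Set Rˣ :=
  minRepsOf cs (lowerTypeMap cs em) (lowerTypeMap cs ep)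
    (doubleCoset cs (typeMap cs em) (typeMap cs ep) (longestElement cs))

/-- `r = σ₋ e₋ σ₀ e₊ σ₊` is a vanilla form of `r`. -/
structure IsVanillaForm [Finite R] (Λ : Set R) (r : R)
    (σm : Rˣ) (em : R) (σ0 : Rˣ) (ep : R) (σp : Rˣ) : Prop where
  eq_prod : r = (σm : R) * em * σ0 * ep * σp
  mem_lattice : ep ∈ Λ
  mem_oppositeLattice : em ∈ oppositeLattice cs Λ
  greenJ_left : GreenJ em r
  greenJ_right : GreenJ r ep
  right_mem : σp ∈ minReps cs (typeMap cs ep) ∅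
  left_mem : σm ∈ minReps cs ∅ (typeMap cs em)
  middle_mem : σ0 ∈ middleSet cs em ep

end Monoid

end RennerCoxeter

/-! Write `r = x e y` with `e ∈ Λ` and put `e₋ = w₀ e w₀`. Split `y = b σ₊` and move `b ∈ W_{λ(e)}`
through `e`; then split `x b w₀ = σ₋ a` with `a ∈ W_{λ(e₋)}`. The middle unit `a w₀` may be replaced
by its minimum modulo `W_{λ_*(e₋)}` and `W_{λ_*(e)}`, because `e` absorbs the change. Finally `e₋ σ
= σ e` on `W_{λ(e₋)} w₀ W_{λ(e)}`, so inserting `e₋` changes nothing.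

For uniqueness, `J`-equivalent idempotents of the finite monoid are conjugate, so the transversal
`Λ` fixes `e₊`, hence `e₋`. If `x e y = x' e y'`, then `y' y⁻¹` and `x⁻¹ x'` centralize `e`; as the
centralizer is `W_{λ(e)}`, minimality determines `σ₊` and `σ₋`. What remains is `σ₀ e = τ₀ e`, so
`σ₀` and `τ₀` are minima of the same double coset.

For the middle set, `W_{λ(e)}` is the product of the commuting subgroups `W_{λ_*(e)}` and
`W_{λ^*(e)}`, with additive lengths. The double cosets in question are `w₀ W_{λ_*(e)} b` with `b ∈
W_{λ^*(e)}`, and `ℓ(w₀ x b) = ℓ(w₀) - ℓ(x) - ℓ(b)`. One and the same `x` therefore gives the minimum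
for every `b`. -/

namespace RennerCoxeter

/-! ### Strong exchange and deletion for Coxeter groups -/

section Exchange

variable {B W : Type*} [Group W] {M : CoxeterMatrix B} (cs : CoxeterSystem M W)

open Classical in
/-- The action of the `i`-th generator in the signed permutation representation on
`W × ZMod 2`. -/
noncomputable def signedSimple (i : B) : Function.End (W × ZMod 2) :=
  fun p => (cs.simple i * p.1 * cs.simple i, p.2 + if p.1 = cs.simple i then 1 else 0)

open Classical in
theorem signedSimple_apply (i : B) (t : W) (z : ZMod 2) :
    signedSimple cs i (t, z) =
      (cs.simple i * t * cs.simple i, z + if t = cs.simple i then 1 else 0) :=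
  rfl

open Classical in
theorem signedSimple_mul_pow_apply (i j : B) (n : ℕ) (t : W) (z : ZMod 2) :
    ((signedSimple cs i * signedSimple cs j) ^ n) (t, z) =
      ((cs.simple i * cs.simple j) ^ n * t * (cs.simple j * cs.simple i) ^ n,
        z + ∑ k ∈ Finset.range (2 * n),
          if t = (cs.simple j * cs.simple i) ^ k * cs.simple j then 1 else 0) := by
  induction n generalizing t z with
  | zero =>
    simp only [pow_zero, one_mul, mul_one, mul_zero, Finset.range_zero, Finset.sum_empty, add_zero]
    rfl
  | succ n ih =>
    have hmul : ∀ (f g : Function.End (W × ZMod 2)) (p : W × ZMod 2), (f * g) p = f (g p) :=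
      fun _ _ _ => rfl
    rw [pow_succ, hmul, hmul, signedSimple_apply, signedSimple_apply, ih]
    refine Prod.ext ?_ ?_
    · rw [pow_succ (cs.simple i * cs.simple j), pow_succ' (cs.simple j * cs.simple i)]
      simp only [mul_assoc]
    · simp only
      rw [show 2 * (n + 1) = 2 * n + 1 + 1 by ring, Finset.sum_range_succ', Finset.sum_range_succ']
      have h1 : ∀ k : ℕ, (cs.simple i * (cs.simple j * t * cs.simple j) * cs.simple i =
          (cs.simple j * cs.simple i) ^ k * cs.simple j) ↔
          t = (cs.simple j * cs.simple i) ^ (k + 1 + 1) * cs.simple j := by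
        intro k
        have hc : (cs.simple j * cs.simple i) ^ (k + 1 + 1) * cs.simple j =
            cs.simple j * (cs.simple i * ((cs.simple j * cs.simple i) ^ k * cs.simple j) *
              cs.simple i) * cs.simple j := by
          rw [pow_succ, pow_succ']
          simp only [mul_assoc]
        rw [hc]
        constructor
        · intro h
          rw [← h]
          simp [mul_assoc]
        · intro h
          rw [h]
          simp [mul_assoc]
      have h2 : (cs.simple j * t * cs.simple j = cs.simple i) ↔
          t = (cs.simple j * cs.simple i) ^ (0 + 1) * cs.simple j := by
        constructor
        · intro h
          rw [← h]
          simp [mul_assoc]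
        · intro h
          rw [h]
          simp [mul_assoc]
      simp only [h1, h2]
      simp only [pow_zero, one_mul]
      ring

/-- At `n = M i j` the sum over `2n` indices consists of two equal halves, since `(s_j s_i)^n = 1`,
and so vanishes mod 2. -/
theorem isLiftable_signedSimple : M.IsLiftable (signedSimple cs) := by
  classical
  intro i j
  funext ⟨t, z⟩
  rw [signedSimple_mul_pow_apply, two_mul, Finset.sum_range_add, cs.simple_mul_simple_pow,
    cs.simple_mul_simple_pow']
  simp only [pow_add, cs.simple_mul_simple_pow', one_mul, mul_one, CharTwo.add_self_eq_zero,
    add_zero]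
  rfl

/-- The signed permutation representation of a Coxeter group. -/
noncomputable def signedRep : W →* Function.End (W × ZMod 2) :=
  cs.lift ⟨signedSimple cs, isLiftable_signedSimple cs⟩

theorem signedRep_simple (i : B) : signedRep cs (cs.simple i) = signedSimple cs i :=
  cs.lift_apply_simple (isLiftable_signedSimple cs) i

-- The parity of the occurrences of `t` in the inversion sequence thus depends only on the group
-- element, not on the word.
open Classical in
theorem signedRep_wordProd (ω : List B) (t : W) (z : ZMod 2) :
    signedRep cs (cs.wordProd ω) (t, z) =
      (cs.wordProd ω * t * (cs.wordProd ω)⁻¹, z + ((cs.rightInvSeq ω).count t : ZMod 2)) := by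
  induction ω with
  | nil => simp; rfl
  | cons i ω ih =>
    have hmul : ∀ (f g : Function.End (W × ZMod 2)) (p : W × ZMod 2), (f * g) p = f (g p) :=
      fun _ _ _ => rfl
    rw [cs.wordProd_cons, map_mul, hmul, ih, signedRep_simple]
    simp only [signedSimple, CoxeterSystem.rightInvSeq, List.count_cons]
    refine Prod.ext ?_ ?_
    · simp [mul_assoc]
    · have h : (cs.wordProd ω * t * (cs.wordProd ω)⁻¹ = cs.simple i) ↔
          ((cs.wordProd ω)⁻¹ * cs.simple i * cs.wordProd ω == t) = true := by
        rw [beq_iff_eq]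
        constructor
        · intro h
          rw [← h]
          group
        · intro h
          rw [← h]
          group
      simp only [h]
      push_cast
      split_ifs <;> ring

theorem signedRep_apply_snd (w t : W) (z : ZMod 2) :
    (signedRep cs w (t, z)).2 = z + (signedRep cs w (t, 0)).2 := by
  classical
  obtain ⟨ω, rfl⟩ := cs.wordProd_surjective w
  simp [signedRep_wordProd]

theorem signedRep_apply_fst (w t : W) (z : ZMod 2) :
    (signedRep cs w (t, z)).1 = w * t * w⁻¹ := by
  classical
  obtain ⟨ω, rfl⟩ := cs.wordProd_surjective w
  simp [signedRep_wordProd]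

theorem signedRep_mul_snd (v w t : W) :
    (signedRep cs (v * w) (t, 0)).2 =
      (signedRep cs w (t, 0)).2 + (signedRep cs v (w * t * w⁻¹, 0)).2 := by
  have hmul : ∀ (f g : Function.End (W × ZMod 2)) (p : W × ZMod 2), (f * g) p = f (g p) :=
    fun _ _ _ => rfl
  rw [map_mul, hmul, ← signedRep_apply_snd cs v]
  rw [← signedRep_apply_fst cs w t 0]

/-- For `t = u s u⁻¹` the contributions of `u` and `u⁻¹` cancel by the cocycle rule, leaving that of
`s` at `s`. -/
theorem signedRep_reflection_snd {t : W} (ht : cs.IsReflection t) :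
    (signedRep cs t (t, 0)).2 = 1 := by
  obtain ⟨u, i, rfl⟩ := ht
  have h1 := signedRep_mul_snd cs u u⁻¹ (u * cs.simple i * u⁻¹)
  rw [mul_inv_cancel, map_one] at h1
  have e1 : u⁻¹ * (u * cs.simple i * u⁻¹) * u⁻¹⁻¹ = cs.simple i := by group
  rw [e1] at h1
  rw [signedRep_mul_snd, e1, signedRep_mul_snd, signedRep_simple]
  have e2 : (signedSimple cs i (cs.simple i, 0)).2 = 1 := by simp [signedSimple]
  rw [e2]
  have e3 : cs.simple i * cs.simple i * (cs.simple i)⁻¹ = cs.simple i := by group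
  rw [e3, add_left_comm, ← h1]
  exact add_zero 1

/-- The strong exchange condition. -/
theorem mem_rightInvSeq_of_isRightInversion (ω : List B) {t : W}
    (ht : cs.IsRightInversion (cs.wordProd ω) t) : t ∈ cs.rightInvSeq ω := by
  classical
  by_contra hn
  have h0 : (signedRep cs (cs.wordProd ω) (t, 0)).2 = 0 := by
    rw [signedRep_wordProd, List.count_eq_zero_of_not_mem hn]
    simp
  have hr := ht.1
  obtain ⟨ξ, hξ, hξw⟩ := cs.exists_isReduced (cs.wordProd ω * t)
  -- Multiplication by `t` flips the sign at `t`, so `t` occurs in the inversion sequence of a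
  -- reduced word of `w t`. It is then an inversion of `w t`, hence not of `w`.
  have h1 : (signedRep cs (cs.wordProd ω * t) (t, 0)).2 = 1 := by
    rw [signedRep_mul_snd, signedRep_reflection_snd cs hr, mul_inv_cancel_right, h0, add_zero]
  have hmem : t ∈ cs.rightInvSeq ξ := by
    by_contra hn'
    rw [hξw, signedRep_wordProd, List.count_eq_zero_of_not_mem hn'] at h1
    simp at h1
  have h2 := (cs.isRightInversion_of_mem_rightInvSeq hξ hmem)
  rw [← hξw, hr.isRightInversion_mul_left_iff] at h2
  exact h2 ht

theorem exists_eraseIdx_of_isRightInversion (ω : List B) {t : W}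
    (ht : cs.IsRightInversion (cs.wordProd ω) t) :
    ∃ j < ω.length, cs.wordProd ω * t = cs.wordProd (ω.eraseIdx j) := by
  obtain ⟨j, hj, rfl⟩ := List.mem_iff_getElem.mp (mem_rightInvSeq_of_isRightInversion cs ω ht)
  refine ⟨j, by simpa using hj, ?_⟩
  rw [← List.getD_eq_getElem _ 1 hj, cs.wordProd_mul_getD_rightInvSeq]

theorem exists_eraseIdx_of_isLeftDescent (ω : List B) {i : B}
    (hi : cs.IsLeftDescent (cs.wordProd ω) i) :
    ∃ j < ω.length, cs.simple i * cs.wordProd ω = cs.wordProd (ω.eraseIdx j) := by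
  have h : cs.IsRightInversion (cs.wordProd ω)
      ((cs.wordProd ω)⁻¹ * cs.simple i * (cs.wordProd ω)⁻¹⁻¹) := by
    refine ⟨(cs.isReflection_simple i).conj _, ?_⟩
    rw [inv_inv, mul_assoc, mul_inv_cancel_left]
    exact hi
  obtain ⟨j, hj, h⟩ := exists_eraseIdx_of_isRightInversion cs ω h
  refine ⟨j, hj, ?_⟩
  rw [← h, inv_inv, mul_assoc, mul_inv_cancel_left]

/-- Every word has a reduced subword with the same product. -/
theorem exists_sublist_isReduced (ω : List B) :
    ∃ ω' : List B, ω'.Sublist ω ∧ cs.IsReduced ω' ∧ cs.wordProd ω' = cs.wordProd ω := by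
  induction ω with
  | nil => exact ⟨[], List.Sublist.refl _, by simp [CoxeterSystem.IsReduced], rfl⟩
  | cons i ω ih =>
    obtain ⟨ω', hs, hr, hp⟩ := ih
    by_cases hd : cs.IsLeftDescent (cs.wordProd ω') i
    · obtain ⟨j, hj, hj'⟩ := exists_eraseIdx_of_isLeftDescent cs ω' hd
      refine ⟨ω'.eraseIdx j, ((List.eraseIdx_sublist _ _).trans hs).cons i, ?_, ?_⟩
      · have h1 := cs.isLeftDescent_iff.1 hd
        have h2 := List.length_eraseIdx_add_one hj
        have h3 := hr.eq
        unfold CoxeterSystem.IsReduced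
        rw [← hj']
        omega
      · rw [← hj', hp, cs.wordProd_cons]
    · refine ⟨i :: ω', hs.cons_cons i, ?_, ?_⟩
      · have h1 := cs.not_isLeftDescent_iff.1 hd
        unfold CoxeterSystem.IsReduced
        rw [cs.wordProd_cons, h1, hr.eq, List.length_cons]
      · rw [cs.wordProd_cons, cs.wordProd_cons, hp]

end Exchange

/-! ### Parabolic subgroups and minimal double coset representatives -/

section Parabolic

variable {B W : Type*} [Group W] {M : CoxeterMatrix B} (cs : CoxeterSystem M W)

theorem simple_mem_parabolic {I : Set B} {i : B} (hi : i ∈ I) :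
    cs.simple i ∈ parabolic cs I :=
  Subgroup.subset_closure (Set.mem_image_of_mem _ hi)

theorem wordProd_mem_parabolic {I : Set B} {ω : List B} (h : ∀ i ∈ ω, i ∈ I) :
    cs.wordProd ω ∈ parabolic cs I := by
  induction ω with
  | nil => simp [one_mem]
  | cons i ω ih =>
    rw [cs.wordProd_cons]
    exact mul_mem (simple_mem_parabolic cs (h i List.mem_cons_self))
      (ih fun k hk => h k (List.mem_cons_of_mem i hk))

theorem exists_word_of_mem_parabolic {I : Set B} {w : W} (hw : w ∈ parabolic cs I) :
    ∃ ω : List B, (∀ i ∈ ω, i ∈ I) ∧ cs.IsReduced ω ∧ cs.wordProd ω = w := by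
  suffices h : ∃ ω : List B, (∀ i ∈ ω, i ∈ I) ∧ cs.wordProd ω = w by
    obtain ⟨ω, h1, h2⟩ := h
    obtain ⟨ω', h3, h4, h5⟩ := exists_sublist_isReduced cs ω
    exact ⟨ω', fun i hi => h1 i (h3.subset hi), h4, h5.trans h2⟩
  induction hw using Subgroup.closure_induction with
  | mem x hx =>
    obtain ⟨i, hi, rfl⟩ := hx
    exact ⟨[i], by simpa using hi, by simp⟩
  | one => exact ⟨[], by simp, by simp⟩
  | mul x y _ _ hx hy =>
    obtain ⟨ω, h1, rfl⟩ := hx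
    obtain ⟨ξ, h2, rfl⟩ := hy
    refine ⟨ω ++ ξ, fun i hi => ?_, cs.wordProd_append _ _⟩
    rcases List.mem_append.1 hi with h | h
    exacts [h1 i h, h2 i h]
  | inv x _ hx =>
    obtain ⟨ω, h1, rfl⟩ := hx
    exact ⟨ω.reverse, fun i hi => h1 i (List.mem_reverse.1 hi), cs.wordProd_reverse ω⟩

theorem parabolic_empty : parabolic cs (∅ : Set B) = ⊥ := by
  simp [parabolic]

theorem mem_doubleCoset_iff {I J : Set B} {u v : W} :
    v ∈ doubleCoset cs I J u ↔
      ∃ a ∈ parabolic cs I, ∃ b ∈ parabolic cs J, v = a * u * b :=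
  DoubleCoset.mem_doubleCoset

theorem mem_doubleCoset_self (I J : Set B) (u : W) : u ∈ doubleCoset cs I J u :=
  (mem_doubleCoset_iff cs).2 ⟨1, one_mem _, 1, one_mem _, by simp⟩

theorem mem_doubleCoset_symm {I J : Set B} {u v : W} (h : v ∈ doubleCoset cs I J u) :
    u ∈ doubleCoset cs I J v := by
  obtain ⟨a, ha, b, hb, rfl⟩ := (mem_doubleCoset_iff cs).1 h
  exact (mem_doubleCoset_iff cs).2 ⟨a⁻¹, inv_mem ha, b⁻¹, inv_mem hb, by group⟩

theorem mem_doubleCoset_trans {I J : Set B} {u v w : W} (h : v ∈ doubleCoset cs I J u)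
    (h' : w ∈ doubleCoset cs I J v) : w ∈ doubleCoset cs I J u := by
  obtain ⟨a, ha, b, hb, rfl⟩ := (mem_doubleCoset_iff cs).1 h
  obtain ⟨c, hc, d, hd, rfl⟩ := (mem_doubleCoset_iff cs).1 h'
  exact (mem_doubleCoset_iff cs).2 ⟨c * a, mul_mem hc ha, b * d, mul_mem hb hd, by group⟩

variable {cs} in
theorem BruhatLE.length_le {u v : W} (h : BruhatLE cs u v) : cs.length u ≤ cs.length v := by
  obtain ⟨ω, ω', h1, rfl, h2, rfl, h3⟩ := h
  rw [h1.eq, h2.eq]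
  exact h3.length_le

variable {cs} in
theorem BruhatLE.eq_of_length_le {u v : W} (h : BruhatLE cs u v)
    (hl : cs.length v ≤ cs.length u) : u = v := by
  obtain ⟨ω, ω', h1, rfl, h2, rfl, h3⟩ := h
  rw [h1.eq, h2.eq] at hl
  rw [h3.eq_of_length_le hl]

theorem minReps_unique {I J : Set B} {u v : W} (hu : u ∈ minReps cs I J)
    (hv : v ∈ minReps cs I J) (h : v ∈ doubleCoset cs I J u) : u = v :=
  (hu v h).eq_of_length_le (hv u (mem_doubleCoset_symm cs h)).length_le

/-- A product `a u b` with `a ∈ W_I`, `b ∈ W_J` and `u` of minimal length in `W_I u W_J` has a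
reduced factorization of the same shape. -/
theorem exists_reduced_factorization {I J : Set B} {u v : W}
    (hu : ∀ x ∈ doubleCoset cs I J u, cs.length u ≤ cs.length x)
    (hv : v ∈ doubleCoset cs I J u) :
    ∃ α β : List B, (∀ i ∈ α, i ∈ I) ∧ (∀ j ∈ β, j ∈ J) ∧
      v = cs.wordProd α * u * cs.wordProd β ∧
      cs.length v = α.length + cs.length u + β.length := by
  obtain ⟨a, ha, b, hb, rfl⟩ := (mem_doubleCoset_iff cs).1 hv
  obtain ⟨α, hα, -, rfl⟩ := exists_word_of_mem_parabolic cs ha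
  obtain ⟨β, hβ, -, rfl⟩ := exists_word_of_mem_parabolic cs hb
  obtain ⟨ω, hω, rfl⟩ := cs.exists_isReduced u
  obtain ⟨ξ, h1, h2, h3⟩ := exists_sublist_isReduced cs (α ++ ω ++ β)
  obtain ⟨ξ', β', rfl, h4, h5⟩ := List.sublist_append_iff.1 h1
  obtain ⟨α', ω', rfl, h6, h7⟩ := List.sublist_append_iff.1 h4
  have hα' : ∀ i ∈ α', i ∈ I := fun i hi => hα i (h6.subset hi)
  have hβ' : ∀ j ∈ β', j ∈ J := fun j hj => hβ j (h5.subset hj)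
  rw [cs.wordProd_append, cs.wordProd_append, cs.wordProd_append, cs.wordProd_append] at h3
  have hmem : cs.wordProd ω' ∈ doubleCoset cs I J (cs.wordProd ω) := by
    refine mem_doubleCoset_trans cs hv ?_
    rw [← h3]
    exact mem_doubleCoset_symm cs ((mem_doubleCoset_iff cs).2
      ⟨_, wordProd_mem_parabolic cs hα', _, wordProd_mem_parabolic cs hβ', rfl⟩)
  have hle := hu _ hmem
  -- The surviving part of `ω` still represents an element of the double coset, so minimality of `u`
  -- allows no deletion in it.
  have : ω' = ω := by
    refine h7.eq_of_length_le ?_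
    rw [← hω.eq]
    exact hle.trans (cs.length_wordProd_le _)
  subst this
  refine ⟨α', β', hα', hβ', h3.symm, ?_⟩
  rw [← h3, ← cs.wordProd_append, ← cs.wordProd_append, h2.eq, hω.eq]
  simp [add_assoc]

/-- In a reduced factorization `α u β`, the first letter of `α` would be a left descent and the last
letter of `β` a right descent. -/
theorem eq_of_no_descent {I J : Set B} {u v : W}
    (hu : ∀ x ∈ doubleCoset cs I J u, cs.length u ≤ cs.length x)
    (hv : v ∈ doubleCoset cs I J u) (hI : ∀ i ∈ I, ¬ cs.IsLeftDescent v i)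
    (hJ : ∀ j ∈ J, ¬ cs.IsRightDescent v j) : v = u := by
  obtain ⟨α, β, hα, hβ, rfl, hl⟩ := exists_reduced_factorization cs hu hv
  have hα0 : α = [] := by
    cases α with
    | nil => rfl
    | cons i α =>
      exfalso
      apply hI i (hα i List.mem_cons_self)
      unfold CoxeterSystem.IsLeftDescent
      rw [hl, cs.wordProd_cons, mul_assoc, mul_assoc, cs.simple_mul_simple_cancel_left]
      have h1 := cs.length_mul_le (cs.wordProd α) (u * cs.wordProd β)
      have h2 := cs.length_mul_le u (cs.wordProd β)
      have h3 := cs.length_wordProd_le α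
      have h4 := cs.length_wordProd_le β
      simp only [List.length_cons]
      omega
  have hβ0 : β = [] := by
    rcases List.eq_nil_or_concat β with h | ⟨β, j, rfl⟩
    · exact h
    · exfalso
      apply hJ j (hβ j (by simp))
      unfold CoxeterSystem.IsRightDescent
      rw [hl, cs.wordProd_concat, ← mul_assoc,
        cs.simple_mul_simple_cancel_right]
      have h1 := cs.length_mul_le (cs.wordProd α * u) (cs.wordProd β)
      have h2 := cs.length_mul_le (cs.wordProd α) u
      have h3 := cs.length_wordProd_le α
      have h4 := cs.length_wordProd_le β
      simp only [List.concat_eq_append, List.length_append, List.length_cons, List.length_nil]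
      omega
  simp [hα0, hβ0]

theorem exists_length_minimal (I J : Set B) (w : W) :
    ∃ u ∈ doubleCoset cs I J w, ∀ x ∈ doubleCoset cs I J u, cs.length u ≤ cs.length x := by
  obtain ⟨u, hu, hmin⟩ := exists_minimal_of_wellFoundedLT
    (fun n => ∃ u ∈ doubleCoset cs I J w, cs.length u = n)
    ⟨_, w, mem_doubleCoset_self cs I J w, rfl⟩
  obtain ⟨u, hu, rfl⟩ := hu
  refine ⟨u, hu, fun x hx => ?_⟩
  by_contra hlt
  exact hlt (hmin ⟨x, mem_doubleCoset_trans cs hu hx, rfl⟩ (by omega))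

theorem length_minimal_of_no_descent {I J : Set B} {v : W}
    (hI : ∀ i ∈ I, ¬ cs.IsLeftDescent v i) (hJ : ∀ j ∈ J, ¬ cs.IsRightDescent v j) :
    ∀ x ∈ doubleCoset cs I J v, cs.length v ≤ cs.length x := by
  obtain ⟨u, hu, hmin⟩ := exists_length_minimal cs I J v
  rw [eq_of_no_descent cs hmin (mem_doubleCoset_symm cs hu) hI hJ]
  exact hmin

/-- Minimal length implies Bruhat-minimal: any `v ≠ u` in the double coset has a descent in `I` or
`J`. Strip it, use induction on length, and put the letter back on the reduced word. -/
theorem mem_minReps_of_length_minimal {I J : Set B} {u : W}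
    (hu : ∀ x ∈ doubleCoset cs I J u, cs.length u ≤ cs.length x) : u ∈ minReps cs I J := by
  intro v hv
  induction hn : cs.length v using Nat.strong_induction_on generalizing v with
  | _ n ih =>
  subst hn
  by_cases hI : ∀ i ∈ I, ¬ cs.IsLeftDescent v i
  · by_cases hJ : ∀ j ∈ J, ¬ cs.IsRightDescent v j
    · rw [eq_of_no_descent cs hu hv hI hJ]
      obtain ⟨ω, hω, rfl⟩ := cs.exists_isReduced u
      exact ⟨ω, ω, hω, rfl, hω, rfl, List.Sublist.refl _⟩
    · push Not at hJ
      obtain ⟨j, hj, hd⟩ := hJ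
      obtain ⟨ω, ω', h1, h2, h3, h4, h5⟩ := ih _ hd (v * cs.simple j)
        (mem_doubleCoset_trans cs hv ((mem_doubleCoset_iff cs).2
          ⟨1, one_mem _, _, simple_mem_parabolic cs hj, by simp⟩)) rfl
      refine ⟨ω ++ [j], ω', ?_, ?_, h3, h4, h5.trans (List.sublist_append_left _ _)⟩
      · have h6 := cs.isRightDescent_iff.1 hd
        rw [← h2, h1.eq] at h6
        unfold CoxeterSystem.IsReduced
        rw [cs.wordProd_append, h2]
        simp [← h6]
      · rw [cs.wordProd_append, h2]
        simp
  · push Not at hI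
    obtain ⟨i, hi, hd⟩ := hI
    obtain ⟨ω, ω', h1, h2, h3, h4, h5⟩ := ih _ hd (cs.simple i * v)
      (mem_doubleCoset_trans cs hv ((mem_doubleCoset_iff cs).2
        ⟨_, simple_mem_parabolic cs hi, 1, one_mem _, by simp⟩)) rfl
    refine ⟨i :: ω, ω', ?_, ?_, h3, h4, h5.cons i⟩
    · have h6 := cs.isLeftDescent_iff.1 hd
      rw [← h2, h1.eq] at h6
      unfold CoxeterSystem.IsReduced
      rw [cs.wordProd_cons, h2]
      simp [← h6]
    · rw [cs.wordProd_cons, h2]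
      simp

theorem exists_minReps (I J : Set B) (w : W) :
    ∃ u ∈ minReps cs I J, u ∈ doubleCoset cs I J w := by
  obtain ⟨u, hu, hmin⟩ := exists_length_minimal cs I J w
  exact ⟨u, mem_minReps_of_length_minimal cs hmin, hu⟩

/-- If no simple reflection from `I` lies in `W_K`, then lengths add up in `W_I W_K`. -/
theorem length_mul_of_disjoint {I K : Set B} (hIK : ∀ i ∈ I, cs.simple i ∉ parabolic cs K)
    {x y : W} (hx : x ∈ parabolic cs I) (hy : y ∈ parabolic cs K) :
    cs.length (x * y) = cs.length x + cs.length y := by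
  -- A left descent `i ∈ I` of `y` would, by exchange inside a word in `K`, put `s_i` into `W_K`.
  have hmin : ∀ z ∈ doubleCoset cs I ∅ y, cs.length y ≤ cs.length z := by
    refine length_minimal_of_no_descent cs (fun i hi hd => hIK i hi ?_) (by simp)
    obtain ⟨ω, h1, -, rfl⟩ := exists_word_of_mem_parabolic cs hy
    obtain ⟨j, -, hj⟩ := exists_eraseIdx_of_isLeftDescent cs ω hd
    rw [← mul_mem_cancel_right hy, hj]
    exact wordProd_mem_parabolic cs fun k hk => h1 k ((List.eraseIdx_sublist _ _).subset hk)
  obtain ⟨α, β, -, hβ, h1, h2⟩ := exists_reduced_factorization cs hmin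
    ((mem_doubleCoset_iff cs).2 ⟨x, hx, 1, one_mem _, (mul_one _).symm⟩)
  have hβ0 : β = [] := List.eq_nil_iff_forall_not_mem.2 fun j hj => hβ j hj
  subst hβ0
  rw [cs.wordProd_nil, mul_one, mul_left_inj] at h1
  have h3 := cs.length_wordProd_le α
  have h4 := cs.length_mul_le x y
  rw [← h1] at h3
  simp only [List.length_nil] at h2
  omega

end Parabolic

/-! ### The longest element -/

section Longest

variable {B W : Type*} [Group W] [Finite W] {M : CoxeterMatrix B} (cs : CoxeterSystem M W)

/-- Let `w = w' s` with `ℓ(w') < ℓ(w)` and `w₀ = w' x`. Every reflection is a right inversion of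
`w₀`, so exchange for `x⁻¹ s x` applies to a word of `w'` followed by one of `x`. The erased letter
cannot lie in `w'`, as `w` is longer; so it lies in `x`, and `s` is a left descent of `x`. -/
theorem length_add_length_inv_mul_longestElement (w : W) :
    cs.length w + cs.length (w⁻¹ * longestElement cs) = cs.length (longestElement cs) := by
  induction hn : cs.length w generalizing w with
  | zero =>
    rw [cs.length_eq_zero_iff] at hn
    simp [hn]
  | succ n ih =>
    have hw : w ≠ 1 := by
      rintro rfl
      simp at hn
    obtain ⟨i, hi⟩ := cs.exists_rightDescent_of_ne_one hw
    have hl := cs.isRightDescent_iff.1 hi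
    set w' := w * cs.simple i with hw'
    have hww : w = w' * cs.simple i := by simp [hw']
    have ih' := ih w' (by omega)
    set x := w'⁻¹ * longestElement cs with hx
    have hx0 : w' * x = longestElement cs := by simp [hx]
    have hwx : w⁻¹ * longestElement cs = cs.simple i * x := by
      rw [hww, ← hx0]
      simp [mul_assoc]
    rw [hwx]
    suffices hd : cs.IsLeftDescent x i by
      have := cs.isLeftDescent_iff.1 hd
      omega
    obtain ⟨ω, hω, hωw⟩ := cs.exists_isReduced w'
    obtain ⟨ξ, hξ, hξx⟩ := cs.exists_isReduced x
    have hprod : cs.wordProd (ω ++ ξ) = longestElement cs := by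
      rw [cs.wordProd_append, ← hωw, ← hξx, hx0]
    have ht : cs.IsReflection (x⁻¹ * cs.simple i * x⁻¹⁻¹) := (cs.isReflection_simple i).conj _
    obtain ⟨j, hj, h⟩ := exists_eraseIdx_of_isRightInversion cs (ω ++ ξ)
      (t := x⁻¹ * cs.simple i * x⁻¹⁻¹) ⟨ht, by
        rw [hprod]
        exact lt_of_le_of_ne (length_le_longestElement cs _) (ht.length_mul_left_ne _)⟩
    have hlhs : cs.wordProd (ω ++ ξ) * (x⁻¹ * cs.simple i * x⁻¹⁻¹) = w * x := by
      rw [hprod, ← hx0, hww]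
      group
    rw [hlhs] at h
    rcases lt_or_ge j ω.length with hj' | hj'
    · exfalso
      rw [List.eraseIdx_append_of_lt_length hj', cs.wordProd_append, ← hξx, mul_left_inj] at h
      have h1 := cs.length_wordProd_le (ω.eraseIdx j)
      have h2 := List.length_eraseIdx_add_one hj'
      have h3 := hω.eq
      rw [← hωw] at h3
      rw [← h] at h1
      omega
    · rw [List.eraseIdx_append_of_length_le hj', cs.wordProd_append, ← hωw, hww, mul_assoc,
        mul_right_inj] at h
      have hjl : j - ω.length < ξ.length := by
        rw [List.length_append] at hj
        omega
      have h1 := cs.length_wordProd_le (ξ.eraseIdx (j - ω.length))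
      have h2 := List.length_eraseIdx_add_one hjl
      have h3 := hξ.eq
      rw [← hξx] at h3
      unfold CoxeterSystem.IsLeftDescent
      rw [h]
      omega

theorem longestElement_mul_self : longestElement cs * longestElement cs = 1 := by
  have h := length_add_length_inv_mul_longestElement cs (longestElement cs)⁻¹
  rw [cs.length_inv, inv_inv] at h
  rw [← cs.length_eq_zero_iff]
  omega

theorem longestElement_inv : (longestElement cs)⁻¹ = longestElement cs :=
  inv_eq_of_mul_eq_one_right (longestElement_mul_self cs)

theorem length_longestElement_mul_add (w : W) :
    cs.length (longestElement cs * w) + cs.length w = cs.length (longestElement cs) := by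
  have h := length_add_length_inv_mul_longestElement cs w
  rw [← cs.length_inv (w⁻¹ * _), mul_inv_rev, inv_inv, longestElement_inv] at h
  omega

theorem exists_longestElement_conj_simple (i : B) :
    ∃ j : B, longestElement cs * cs.simple i * longestElement cs = cs.simple j := by
  rw [← cs.length_eq_one_iff]
  have h1 := length_longestElement_mul_add cs (cs.simple i)
  have h2 := length_add_length_inv_mul_longestElement cs (longestElement cs * cs.simple i)⁻¹
  rw [cs.length_inv, inv_inv] at h2
  rw [cs.length_simple] at h1
  omega

end Longest

end RennerCoxeter

namespace RennerCoxeter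

/-! ### Idempotents, units and Green's relation in factorizable monoids -/

section Monoid

variable {R : Type*} [Monoid R]

theorem isIdempotentElem_units_conj {e : R} (he : IsIdempotentElem e) (w : Rˣ) :
    IsIdempotentElem ((w : R) * e * (w⁻¹ : Rˣ)) := by
  have he' : e * e = e := he
  unfold IsIdempotentElem
  calc (w : R) * e * (w⁻¹ : Rˣ) * (w * e * (w⁻¹ : Rˣ))
      = w * (e * ((w⁻¹ : Rˣ) * w) * e) * (w⁻¹ : Rˣ) := by simp only [mul_assoc]
    _ = w * e * (w⁻¹ : Rˣ) := by rw [Units.inv_mul, mul_one, he']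

/-- Generating the same left ideal gives `e g = e` and `g e = g`; commuting idempotents then
coincide. -/
theorem IsFactorizable.eq_of_eq_unit_mul (h : IsFactorizable R) {e g : R} {u : Rˣ}
    (he : IsIdempotentElem e) (hg : IsIdempotentElem g) (heg : e = u * g) : e = g := by
  have h1 : e * g = e := by rw [heg, mul_assoc, hg.eq]
  have h2 : g = (u⁻¹ : Rˣ) * e := by rw [heg, Units.inv_mul_cancel_left]
  have h3 : g * e = g := by rw [h2, mul_assoc, he.eq]
  rw [← h1, h.idem_commute e g he hg, h3]

theorem IsFactorizable.eq_of_eq_mul_unit (h : IsFactorizable R) {e g : R} {u : Rˣ}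
    (he : IsIdempotentElem e) (hg : IsIdempotentElem g) (heg : e = g * u) : e = g := by
  have h1 : g * e = e := by rw [heg, ← mul_assoc, hg.eq]
  have h2 : g = e * (u⁻¹ : Rˣ) := by rw [heg, Units.mul_inv_cancel_right]
  have h3 : e * g = g := by rw [h2, ← mul_assoc, he.eq]
  rw [← h1, h.idem_commute g e hg he, h3]

/-- A unit that fixes an idempotent on the left fixes it on the right. -/
theorem IsFactorizable.mul_unit_eq_of_unit_mul_eq (h : IsFactorizable R) {e : R} {u : Rˣ}
    (he : IsIdempotentElem e) (hu : (u : R) * e = e) : e * u = e := by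
  have hg := isIdempotentElem_units_conj he u
  rw [hu] at hg
  have h1 : e = e * (u⁻¹ : Rˣ) :=
    h.eq_of_eq_mul_unit he hg (u := u) (by rw [Units.inv_mul_cancel_right])
  exact (Units.eq_mul_inv_iff_mul_eq _).1 h1

/-- The equation makes `e` a unit times a conjugate of `e`, so `e` equals that conjugate. -/
theorem IsFactorizable.commute_right_of_eq (h : IsFactorizable R) {e : R}
    (he : IsIdempotentElem e) {x y x' y' : Rˣ} (hxy : (x : R) * e * y = x' * e * y') :
    ((y' * y⁻¹ : Rˣ) : R) * e = e * (y' * y⁻¹ : Rˣ) := by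
  set v := y' * y⁻¹ with hv
  have h1 : e = ((x⁻¹ * x' * v : Rˣ) : R) * ((v⁻¹ : Rˣ) * e * (v⁻¹⁻¹ : Rˣ)) := by
    have h2 : e = (x⁻¹ : Rˣ) * ((x : R) * e * y) * (y⁻¹ : Rˣ) := by
      simp [mul_assoc]
    rw [hxy] at h2
    simpa [hv, mul_assoc] using h2
  have h3 := h.eq_of_eq_unit_mul he (isIdempotentElem_units_conj he v⁻¹) h1
  rw [inv_inv, mul_assoc] at h3
  exact (Units.eq_inv_mul_iff_mul_eq _).1 h3

theorem IsFactorizable.commute_left_of_eq (h : IsFactorizable R) {e : R}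
    (he : IsIdempotentElem e) {x y x' y' : Rˣ} (hxy : (x : R) * e * y = x' * e * y') :
    ((x⁻¹ * x' : Rˣ) : R) * e = e * (x⁻¹ * x' : Rˣ) := by
  set u := x⁻¹ * x' with hu
  have h1 : e = ((u : R) * e * (u⁻¹ : Rˣ)) * (u * (y' * y⁻¹) : Rˣ) := by
    have h2 : e = (x⁻¹ : Rˣ) * ((x : R) * e * y) * (y⁻¹ : Rˣ) := by
      simp [mul_assoc]
    rw [hxy] at h2
    simpa [hu, mul_assoc] using h2
  have h3 := h.eq_of_eq_mul_unit he (isIdempotentElem_units_conj he u) h1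
  exact ((Units.eq_mul_inv_iff_mul_eq _).1 h3).symm

theorem greenJ_of_eq {r s a b c d : R} (h1 : r = a * s * b) (h2 : s = c * r * d) :
    GreenJ r s := by
  unfold GreenJ
  ext x
  constructor
  · rintro ⟨p, q, rfl⟩
    exact ⟨p * a, b * q, by rw [h1]; simp only [mul_assoc]⟩
  · rintro ⟨p, q, rfl⟩
    exact ⟨p * c, d * q, by rw [h2]; simp only [mul_assoc]⟩

theorem GreenJ.exists_eq {r s : R} (h : GreenJ r s) : ∃ a b : R, r = a * s * b := by
  have : r ∈ {x : R | ∃ a b : R, x = a * r * b} := ⟨1, 1, by simp⟩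
  rw [h] at this
  exact this

theorem GreenJ.symm {r s : R} (h : GreenJ r s) : GreenJ s r :=
  Eq.symm h

theorem GreenJ.trans {r s t : R} (h : GreenJ r s) (h' : GreenJ s t) : GreenJ r t :=
  Eq.trans h h'

theorem greenJ_unit_mul_mul_unit (x y : Rˣ) (e : R) : GreenJ ((x : R) * e * y) e :=
  greenJ_of_eq (a := x) (b := y) (c := (x⁻¹ : Rˣ)) (d := (y⁻¹ : Rˣ)) rfl (by simp [mul_assoc])

/-- An idempotent in `R f R` is conjugate to an idempotent below `f`. -/
theorem IsFactorizable.exists_conj_mul_eq (h : IsFactorizable R) {e f a b : R}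
    (he : IsIdempotentElem e) (hf : IsIdempotentElem f) (hab : e = a * f * b) :
    ∃ v : Rˣ, (v : R) * e * (v⁻¹ : Rˣ) * f = v * e * (v⁻¹ : Rˣ) := by
  obtain ⟨w, g, hg, rfl⟩ := h.exists_unit_mul_idem a
  obtain ⟨k, v, hk, rfl⟩ := h.exists_idem_mul_unit b
  have hgf := (h.mul_isMeet hg hf).1
  have hgfk := (h.mul_isMeet hgf hk).1
  have h1 : e = ((w * v : Rˣ) : R) * ((v⁻¹ : Rˣ) * (g * f * k) * (v⁻¹⁻¹ : Rˣ)) := by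
    rw [hab]
    simp [mul_assoc]
  have h2 := h.eq_of_eq_unit_mul he (isIdempotentElem_units_conj hgfk v⁻¹) h1
  refine ⟨v, ?_⟩
  have h3 : (v : R) * e * (v⁻¹ : Rˣ) = g * f * k := by
    rw [h2]
    simp [mul_assoc]
  rw [h3, mul_assoc, h.idem_commute k f hk hf, ← mul_assoc, mul_assoc g, hf.eq]

/-- The idempotents below `e`. -/
def idemBelow (e : R) : Set R := {x | IsIdempotentElem x ∧ x * e = x}

theorem ncard_idemBelow_le [Finite R] {e f : R} {v : Rˣ}
    (hv : (v : R) * e * (v⁻¹ : Rˣ) * f = v * e * (v⁻¹ : Rˣ)) :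
    (idemBelow e).ncard ≤ (idemBelow f).ncard := by
  refine Set.ncard_le_ncard_of_injOn (fun x => (v : R) * x * (v⁻¹ : Rˣ)) ?_ ?_
    (Set.toFinite _)
  · rintro x ⟨hx, hxe⟩
    refine ⟨isIdempotentElem_units_conj hx v, ?_⟩
    have h1 : (v : R) * x * (v⁻¹ : Rˣ) = v * x * (v⁻¹ : Rˣ) * (v * e * (v⁻¹ : Rˣ)) := by
      conv_lhs => rw [← hxe]
      simp [mul_assoc]
    rw [h1, mul_assoc, hv]
  · intro x _ y _ hxy
    simpa using hxy

/-- Each idempotent has a conjugate below the other. Counting the idempotents below them forces the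
conjugate `k ≤ f` of `e` to have as many below it as `f`, so `f ≤ k`. -/
theorem IsFactorizable.exists_conj_of_greenJ [Finite R] (h : IsFactorizable R) {e f : R}
    (he : IsIdempotentElem e) (hf : IsIdempotentElem f) (hef : GreenJ e f) :
    ∃ v : Rˣ, (v : R) * e * (v⁻¹ : Rˣ) = f := by
  obtain ⟨a, b, hab⟩ := hef.exists_eq
  obtain ⟨c, d, hcd⟩ := hef.symm.exists_eq
  obtain ⟨v, hv⟩ := h.exists_conj_mul_eq he hf hab
  obtain ⟨u, hu⟩ := h.exists_conj_mul_eq hf he hcd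
  refine ⟨v, ?_⟩
  set k := (v : R) * e * (v⁻¹ : Rˣ) with hk
  have hki : IsIdempotentElem k := isIdempotentElem_units_conj he v
  have h1 := ncard_idemBelow_le hu
  have h2 : (idemBelow e).ncard ≤ (idemBelow k).ncard := ncard_idemBelow_le (v := v) hki
  have h3 : idemBelow k ⊆ idemBelow f := by
    rintro x ⟨hx, hxk⟩
    exact ⟨hx, by rw [← hxk, mul_assoc, hv]⟩
  have h4 := Set.eq_of_subset_of_ncard_le h3 (h1.trans h2) (Set.toFinite _)
  have h5 : f ∈ idemBelow k := by
    rw [h4]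
    exact ⟨hf, hf⟩
  rw [← h5.2, h.idem_commute f k hf hki, hv]

end Monoid

/-! ### Type maps and the splitting of the centralizer -/

section System

variable {R : Type*} [Monoid R] {B : Type*} {M : CoxeterMatrix B} (cs : CoxeterSystem M Rˣ)

variable {cs} in
theorem IsRennerCoxeterSystem.eq_of_greenJ [Finite R] {Λ : Set R}
    (h : IsRennerCoxeterSystem cs Λ) {e f : R} (he : e ∈ Λ) (hf : f ∈ Λ) (hef : GreenJ e f) :
    e = f := by
  have hei := h.isIdempotentElem e he
  exact (h.transversal e hei).unique ⟨he, 1, by simp⟩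
    ⟨hf, h.factorizable.exists_conj_of_greenJ hei (h.isIdempotentElem f hf) hef⟩

variable {cs} in
theorem IsRennerCoxeterSystem.exists_eq_unit_mul_mul_unit {Λ : Set R}
    (h : IsRennerCoxeterSystem cs Λ) (r : R) : ∃ e ∈ Λ, ∃ x y : Rˣ, r = x * e * y := by
  obtain ⟨g, w, hg, rfl⟩ := h.factorizable.exists_idem_mul_unit r
  obtain ⟨f, ⟨hf, v, rfl⟩, -⟩ := h.transversal g hg
  exact ⟨_, hf, v⁻¹, v * w, by simp [mul_assoc]⟩

variable {cs} in
theorem IsRennerCoxeterSystem.mem_parabolic_typeMap_iff {Λ : Set R}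
    (h : IsRennerCoxeterSystem cs Λ) {e : R} (he : e ∈ Λ) {w : Rˣ} :
    w ∈ parabolic cs (typeMap cs e) ↔ (w : R) * e = e * w := by
  rw [← SetLike.mem_coe, h.parabolic_typeMap cs he, Set.mem_ofPred_eq]

variable {cs} in
theorem IsRennerCoxeterSystem.mem_parabolic_lowerTypeMap_iff {Λ : Set R}
    (h : IsRennerCoxeterSystem cs Λ) {e : R} (he : e ∈ Λ) {w : Rˣ} :
    w ∈ parabolic cs (lowerTypeMap cs e) ↔ (w : R) * e = e := by
  rw [← SetLike.mem_coe, h.parabolic_lowerTypeMap cs he, Set.mem_ofPred_eq]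
  constructor
  · rintro ⟨h1, h2⟩
    rw [h1, h2]
  · intro h1
    have h2 := h.factorizable.mul_unit_eq_of_unit_mul_eq (h.isIdempotentElem e he) h1
    exact ⟨by rw [h1, h2], h2⟩

theorem lowerTypeMap_subset (e : R) : lowerTypeMap cs e ⊆ typeMap cs e :=
  fun _ hi => hi.1

theorem upperTypeMap_subset (e : R) : upperTypeMap cs e ⊆ typeMap cs e :=
  fun _ hi => hi.1

theorem parabolic_mono {W : Type*} [Group W] (cs : CoxeterSystem M W) {I J : Set B}
    (h : I ⊆ J) : parabolic cs I ≤ parabolic cs J :=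
  Subgroup.closure_mono (Set.image_mono h)

variable {cs} in
theorem IsRennerCoxeterSystem.simple_upper_notMem {Λ : Set R}
    (h : IsRennerCoxeterSystem cs Λ) {e : R} (he : e ∈ Λ) :
    ∀ k ∈ upperTypeMap cs e, cs.simple k ∉ parabolic cs (lowerTypeMap cs e) := by
  intro k hk hmem
  rw [h.mem_parabolic_lowerTypeMap_iff he, hk.1] at hmem
  exact hk.2 hmem

variable {cs} in
theorem IsRennerCoxeterSystem.length_upper_mul_lower {Λ : Set R}
    (h : IsRennerCoxeterSystem cs Λ) {e : R} (he : e ∈ Λ) {x y : Rˣ}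
    (hx : x ∈ parabolic cs (upperTypeMap cs e)) (hy : y ∈ parabolic cs (lowerTypeMap cs e)) :
    cs.length (x * y) = cs.length x + cs.length y :=
  length_mul_of_disjoint cs (h.simple_upper_notMem he) hx hy

variable {cs} in
-- The conjugate `s_k s_i s_k` still fixes `e`, and additivity of length forces it to have length 1.
-- Exchange in `s_i s_k` then gives `s_k s_i s_k = s_k`, impossible as `s_k` does not fix `e`, or
-- `s_k s_i s_k = s_i`.
theorem IsRennerCoxeterSystem.simple_commute {Λ : Set R}
    (h : IsRennerCoxeterSystem cs Λ) {e : R} (he : e ∈ Λ) {i k : B}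
    (hi : i ∈ lowerTypeMap cs e) (hk : k ∈ upperTypeMap cs e) :
    Commute (cs.simple i) (cs.simple k) := by
  have hxmem : cs.simple k * cs.simple i * cs.simple k ∈ parabolic cs (lowerTypeMap cs e) := by
    rw [h.mem_parabolic_lowerTypeMap_iff he]
    push_cast
    have h1 : (cs.simple i : R) * e = e := by rw [hi.1, hi.2]
    rw [mul_assoc, hk.1, ← mul_assoc, mul_assoc (cs.simple k : R), h1, hk.1, mul_assoc,
      ← Units.val_mul, cs.simple_mul_simple_self, Units.val_one, mul_one]
  have hkmem := simple_mem_parabolic cs hk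
  have himem := simple_mem_parabolic cs hi
  have h1 := h.length_upper_mul_lower he hkmem hxmem
  have h2 := h.length_upper_mul_lower he hkmem himem
  have h3 : cs.simple k * (cs.simple k * cs.simple i * cs.simple k) =
      cs.simple i * cs.simple k := by
    simp [mul_assoc]
  rw [h3] at h1
  rw [← cs.length_inv, mul_inv_rev, cs.inv_simple, cs.inv_simple] at h2
  have hx1 : cs.length (cs.simple k * cs.simple i * cs.simple k) = 1 := by
    rw [h2] at h1
    simp only [cs.length_simple] at h1
    omega
  have hd : cs.IsLeftDescent (cs.wordProd [i, k]) k := by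
    unfold CoxeterSystem.IsLeftDescent
    rw [cs.wordProd_cons, cs.wordProd_singleton, ← mul_assoc, hx1, h2]
    simp
  obtain ⟨j, hj, hjk⟩ := exists_eraseIdx_of_isLeftDescent cs [i, k] hd
  rw [cs.wordProd_cons, cs.wordProd_singleton, ← mul_assoc] at hjk
  have hj2 : j = 0 ∨ j = 1 := by
    simp only [List.length_cons, List.length_nil] at hj
    omega
  rcases hj2 with rfl | rfl
  · exfalso
    simp only [List.eraseIdx_zero, List.tail_cons, cs.wordProd_singleton] at hjk
    rw [hjk] at hxmem
    exact h.simple_upper_notMem he k hk hxmem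
  · simp only [List.eraseIdx_cons_succ, List.eraseIdx_cons_zero, cs.wordProd_singleton] at hjk
    have := congrArg (cs.simple k * ·) hjk
    simp only [h3] at this
    exact this

variable {cs} in
theorem IsRennerCoxeterSystem.commute_lower_upper {Λ : Set R}
    (h : IsRennerCoxeterSystem cs Λ) {e : R} (he : e ∈ Λ) {x y : Rˣ}
    (hx : x ∈ parabolic cs (lowerTypeMap cs e)) (hy : y ∈ parabolic cs (upperTypeMap cs e)) :
    Commute x y := by
  induction hx using Subgroup.closure_induction with
  | mem x hx =>
    obtain ⟨i, hi, rfl⟩ := hx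
    induction hy using Subgroup.closure_induction with
    | mem y hy =>
      obtain ⟨k, hk, rfl⟩ := hy
      exact h.simple_commute he hi hk
    | one => exact Commute.one_right _
    | mul a b _ _ ha hb => exact ha.mul_right hb
    | inv a _ ha => exact ha.inv_right
  | one => exact Commute.one_left _
  | mul a b _ _ ha hb => exact ha.mul_left hb
  | inv a _ ha => exact ha.inv_left

/-- `W_{λ(e)} = W_{λ_*(e)} W_{λ^*(e)}`. -/
theorem IsRennerCoxeterSystem.exists_lower_mul_upper {cs : CoxeterSystem M Rˣ} {Λ : Set R}
    (h : IsRennerCoxeterSystem cs Λ) {e : R} (he : e ∈ Λ) {z : Rˣ}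
    (hz : z ∈ parabolic cs (typeMap cs e)) :
    ∃ y ∈ parabolic cs (lowerTypeMap cs e), ∃ b ∈ parabolic cs (upperTypeMap cs e),
      z = y * b := by
  induction hz using Subgroup.closure_induction with
  | mem x hx =>
    obtain ⟨i, hi, rfl⟩ := hx
    by_cases hie : e * cs.simple i = e
    · exact ⟨_, simple_mem_parabolic cs ⟨hi, hie⟩, 1, one_mem _, (mul_one _).symm⟩
    · exact ⟨1, one_mem _, _, simple_mem_parabolic cs ⟨hi, hie⟩, (one_mul _).symm⟩
  | one => exact ⟨1, one_mem _, 1, one_mem _, (one_mul _).symm⟩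
  | mul x x' _ _ hx hx' =>
    obtain ⟨y, hy, b, hb, rfl⟩ := hx
    obtain ⟨y', hy', b', hb', rfl⟩ := hx'
    refine ⟨y * y', MulMemClass.mul_mem hy hy', b * b', MulMemClass.mul_mem hb hb', ?_⟩
    have hc := h.commute_lower_upper he hy' hb
    rw [mul_assoc, ← mul_assoc b, ← hc.eq]
    simp only [mul_assoc]
  | inv x _ hx =>
    obtain ⟨y, hy, b, hb, rfl⟩ := hx
    refine ⟨y⁻¹, inv_mem hy, b⁻¹, inv_mem hb, ?_⟩
    rw [mul_inv_rev]
    exact (h.commute_lower_upper he (inv_mem hy) (inv_mem hb)).eq.symm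

theorem mul_eq_mul_of_mem_parabolic_typeMap {e : R} {x : Rˣ}
    (hx : x ∈ parabolic cs (typeMap cs e)) : (x : R) * e = e * x := by
  induction hx using Subgroup.closure_induction with
  | mem x hx =>
    obtain ⟨i, hi, rfl⟩ := hx
    exact hi
  | one => simp
  | mul x y _ _ hx hy =>
    push_cast
    rw [mul_assoc, hy, ← mul_assoc, hx, mul_assoc]
  | inv x _ hx =>
    rw [Units.inv_mul_eq_iff_eq_mul, ← mul_assoc, hx, Units.mul_inv_cancel_right]

/-! ### Conjugation by the longest element -/

section Opposite

variable [Finite R]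

/-- The conjugate `w₀ e w₀`. -/
noncomputable def opp (e : R) : R :=
  ((longestElement cs : Rˣ) : R) * e * (longestElement cs : Rˣ)

theorem longestElement_mul_cancel_left (e : R) :
    ((longestElement cs : Rˣ) : R) * ((longestElement cs : Rˣ) * e) = e := by
  rw [← mul_assoc, ← Units.val_mul, longestElement_mul_self, Units.val_one, one_mul]

theorem longestElement_val_mul_self :
    ((longestElement cs : Rˣ) : R) * (longestElement cs : Rˣ) = 1 := by
  rw [← Units.val_mul, longestElement_mul_self, Units.val_one]

theorem opp_opp (e : R) : opp cs (opp cs e) = e := by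
  simp only [opp, mul_assoc, longestElement_val_mul_self, mul_one, longestElement_mul_cancel_left]

theorem opp_mul (e f : R) : opp cs (e * f) = opp cs e * opp cs f := by
  simp only [opp, mul_assoc, longestElement_mul_cancel_left]

theorem opp_injective : Function.Injective (opp cs : R → R) :=
  Function.LeftInverse.injective (g := opp cs) (opp_opp cs)

theorem val_opp (x : Rˣ) :
    ((longestElement cs * x * longestElement cs : Rˣ) : R) = opp cs (x : R) := by
  simp [opp]

/-- Conjugation by `w₀` permutes the simple reflections; `hIJ` says that this permutation carries
`I` into `J`. -/
theorem conj_mem_parabolic {I J : Set B}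
    (hIJ : ∀ i ∈ I, ∀ j, longestElement cs * cs.simple i * longestElement cs = cs.simple j →
      j ∈ J) {x : Rˣ} (hx : x ∈ parabolic cs I) :
    longestElement cs * x * longestElement cs ∈ parabolic cs J := by
  have hw := longestElement_mul_self cs
  induction hx using Subgroup.closure_induction with
  | mem x hx =>
    obtain ⟨i, hi, rfl⟩ := hx
    obtain ⟨j, hj⟩ := exists_longestElement_conj_simple cs i
    rw [hj]
    exact simple_mem_parabolic cs (hIJ i hi j hj)
  | one => simp [hw, one_mem]
  | mul x y _ _ hx hy =>
    have : longestElement cs * (x * y) * longestElement cs =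
        (longestElement cs * x * longestElement cs) *
          (longestElement cs * y * longestElement cs) := by
      rw [mul_assoc _ (longestElement cs) (longestElement cs * y * _), mul_assoc _ y,
        ← mul_assoc (longestElement cs) (longestElement cs), hw, one_mul]
      simp only [mul_assoc]
    rw [this]
    exact mul_mem hx hy
  | inv x _ hx =>
    have := inv_mem hx
    rwa [mul_inv_rev, mul_inv_rev, longestElement_inv, ← mul_assoc] at this

theorem conj_mem_parabolic_typeMap {e : R} {x : Rˣ} (hx : x ∈ parabolic cs (typeMap cs e)) :
    longestElement cs * x * longestElement cs ∈ parabolic cs (typeMap cs (opp cs e)) := by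
  refine conj_mem_parabolic cs (fun i hi j hij => ?_) hx
  have hi' : (cs.simple i : R) * e = e * cs.simple i := hi
  change (cs.simple j : R) * _ = _ * _
  rw [← hij, val_opp, ← opp_mul, ← opp_mul, hi']

theorem conj_mem_parabolic_lowerTypeMap {e : R} {x : Rˣ}
    (hx : x ∈ parabolic cs (lowerTypeMap cs e)) :
    longestElement cs * x * longestElement cs ∈ parabolic cs (lowerTypeMap cs (opp cs e)) := by
  refine conj_mem_parabolic cs (fun i hi j hij => ?_) hx
  change (cs.simple j : R) * _ = _ * _ ∧ _ * (cs.simple j : R) = _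
  rw [← hij, val_opp, ← opp_mul, ← opp_mul, hi.1, hi.2]
  exact ⟨rfl, rfl⟩

theorem conj_mem_parabolic_upperTypeMap {e : R} {x : Rˣ}
    (hx : x ∈ parabolic cs (upperTypeMap cs e)) :
    longestElement cs * x * longestElement cs ∈ parabolic cs (upperTypeMap cs (opp cs e)) := by
  refine conj_mem_parabolic cs (fun i hi j hij => ?_) hx
  change (cs.simple j : R) * _ = _ * _ ∧ _ * (cs.simple j : R) ≠ _
  rw [← hij, val_opp, ← opp_mul, ← opp_mul, hi.1]
  exact ⟨rfl, fun hn => hi.2 (opp_injective cs hn)⟩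

theorem longestElement_conj_conj (x : Rˣ) :
    longestElement cs * (longestElement cs * x * longestElement cs) * longestElement cs = x := by
  have hw := longestElement_mul_self cs
  rw [mul_assoc, mul_assoc, hw, mul_one, ← mul_assoc, hw, one_mul]

theorem longestElement_mul_conj (x : Rˣ) :
    longestElement cs * (longestElement cs * x * longestElement cs) =
      x * longestElement cs := by
  have hw := longestElement_mul_self cs
  rw [mul_assoc, ← mul_assoc, hw, one_mul]

theorem conj_mul_longestElement (x : Rˣ) :
    longestElement cs * x * longestElement cs * longestElement cs = longestElement cs * x := by
  rw [mul_assoc, longestElement_mul_self, mul_one]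

end Opposite

end System

end RennerCoxeter

namespace RennerCoxeter

/-! ### Existence, uniqueness and the middle set -/

section Vanilla

variable {R : Type*} [Monoid R] [Finite R] {B : Type*} {M : CoxeterMatrix B}
  {cs : CoxeterSystem M Rˣ} {Λ : Set R}

/-- Holds for `w₀` by definition of `opp`; the outer factors commute with their idempotents. This
collapses `e₋ σ₀ e₊` to `σ₀ e₊`. -/
theorem opp_mul_eq_mul_of_mem {e : R} {σ : Rˣ}
    (hσ : σ ∈ doubleCoset cs (typeMap cs (opp cs e)) (typeMap cs e) (longestElement cs)) :
    opp cs e * σ = σ * e := by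
  obtain ⟨a, ha, b, hb, rfl⟩ := (mem_doubleCoset_iff cs).1 hσ
  have h1 := mul_eq_mul_of_mem_parabolic_typeMap cs ha
  have h2 := mul_eq_mul_of_mem_parabolic_typeMap cs hb
  have h3 : opp cs e * (longestElement cs : Rˣ) = (longestElement cs : Rˣ) * e := by
    rw [opp, mul_assoc, longestElement_val_mul_self, mul_one]
  push_cast
  rw [← mul_assoc, ← mul_assoc, ← h1, mul_assoc (a : R), h3, mul_assoc _ _ e, h2]
  simp only [mul_assoc]

theorem middleSet_subset {em ep : R} {σ : Rˣ} (hσ : σ ∈ middleSet cs em ep) :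
    σ ∈ doubleCoset cs (typeMap cs em) (typeMap cs ep) (longestElement cs) := by
  obtain ⟨-, x, hx, hσx⟩ := hσ
  refine mem_doubleCoset_trans cs hx ?_
  obtain ⟨a, ha, b, hb, rfl⟩ := (mem_doubleCoset_iff cs).1 hσx
  exact (mem_doubleCoset_iff cs).2
    ⟨a, parabolic_mono cs (lowerTypeMap_subset cs em) ha, b,
      parabolic_mono cs (lowerTypeMap_subset cs ep) hb, rfl⟩

theorem longestElement_mul_mem {e : R} {z : Rˣ} (hz : z ∈ parabolic cs (typeMap cs e)) :
    longestElement cs * z ∈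
      doubleCoset cs (typeMap cs (opp cs e)) (typeMap cs e) (longestElement cs) :=
  (mem_doubleCoset_iff cs).2 ⟨1, one_mem _, z, hz, by simp⟩

/-- Conjugation by `w₀` moves the left factor into `W_{λ(e)}`, so the double coset is a single left
coset of it. -/
theorem exists_of_mem_doubleCoset_longestElement {e : R} {u : Rˣ}
    (hu : u ∈ doubleCoset cs (typeMap cs (opp cs e)) (typeMap cs e) (longestElement cs)) :
    ∃ z ∈ parabolic cs (typeMap cs e), u = longestElement cs * z := by
  obtain ⟨a, ha, b, hb, rfl⟩ := (mem_doubleCoset_iff cs).1 hu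
  have ha' := conj_mem_parabolic_typeMap cs ha
  rw [opp_opp] at ha'
  exact ⟨_, MulMemClass.mul_mem ha' hb, by rw [← mul_assoc, longestElement_mul_conj]⟩

/-- The double coset `W_{λ_*(e₋)} w₀ y b W_{λ_*(e)}` is `w₀ W_{λ_*(e)} b`. -/
theorem IsRennerCoxeterSystem.mem_lower_doubleCoset_iff (h : IsRennerCoxeterSystem cs Λ) {e : R}
    (he : e ∈ Λ) {y b v : Rˣ} (hy : y ∈ parabolic cs (lowerTypeMap cs e))
    (hb : b ∈ parabolic cs (upperTypeMap cs e)) :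
    v ∈ doubleCoset cs (lowerTypeMap cs (opp cs e)) (lowerTypeMap cs e)
        (longestElement cs * (y * b)) ↔
      ∃ x ∈ parabolic cs (lowerTypeMap cs e), v = longestElement cs * (x * b) := by
  rw [mem_doubleCoset_iff]
  constructor
  · rintro ⟨a, ha, c, hc, rfl⟩
    have ha' := conj_mem_parabolic_lowerTypeMap cs ha
    rw [opp_opp] at ha'
    refine ⟨_, MulMemClass.mul_mem (MulMemClass.mul_mem ha' hy) hc, ?_⟩
    have hcb := (h.commute_lower_upper he hc hb).eq
    rw [mul_assoc _ c b, hcb, ← mul_assoc, ← mul_assoc, ← mul_assoc, ← mul_assoc, ← mul_assoc,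
      longestElement_mul_conj]
  · rintro ⟨x, hx, rfl⟩
    refine ⟨longestElement cs * (x * y⁻¹) * longestElement cs,
      conj_mem_parabolic_lowerTypeMap cs (MulMemClass.mul_mem hx (inv_mem hy)), 1, one_mem _, ?_⟩
    rw [mul_one, ← mul_assoc _ _ (y * b), conj_mul_longestElement]
    group

theorem IsRennerCoxeterSystem.exists_vanillaForm (h : IsRennerCoxeterSystem cs Λ) (r : R) :
    ∃ e ∈ Λ, ∃ σm σ0 σp : Rˣ, IsVanillaForm cs Λ r σm (opp cs e) σ0 e σp := by
  obtain ⟨e, he, x, y, rfl⟩ := h.exists_eq_unit_mul_mul_unit r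
  have hJ := greenJ_unit_mul_mul_unit x y e
  obtain ⟨σp, hσp, hσpy⟩ := exists_minReps cs (typeMap cs e) ∅ y
  obtain ⟨b, hb, b', hb', hyb⟩ := (mem_doubleCoset_iff cs).1 (mem_doubleCoset_symm cs hσpy)
  rw [parabolic_empty, Subgroup.mem_bot] at hb'
  rw [hb', mul_one] at hyb
  obtain ⟨σm, hσm, hσmx⟩ :=
    exists_minReps cs ∅ (typeMap cs (opp cs e)) (x * b * longestElement cs)
  obtain ⟨a', ha', a, ha, hxa⟩ := (mem_doubleCoset_iff cs).1 (mem_doubleCoset_symm cs hσmx)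
  rw [parabolic_empty, Subgroup.mem_bot] at ha'
  rw [ha', one_mul] at hxa
  have hxb : x * b = σm * (a * longestElement cs) := by
    rw [← mul_assoc, ← hxa, mul_assoc, longestElement_mul_self, mul_one]
  have hamem : a * longestElement cs ∈
      doubleCoset cs (typeMap cs (opp cs e)) (typeMap cs e) (longestElement cs) :=
    (mem_doubleCoset_iff cs).2 ⟨a, ha, 1, one_mem _, by simp⟩
  obtain ⟨σ0, hσ0, hσ0a⟩ := exists_minReps cs (lowerTypeMap cs (opp cs e)) (lowerTypeMap cs e)
    (a * longestElement cs)
  have hmid : σ0 ∈ middleSet cs (opp cs e) e := ⟨hσ0, _, hamem, hσ0a⟩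
  refine ⟨e, he, σm, σ0, σp, ?_, he, ⟨e, he, rfl⟩, ?_, hJ, hσp, hσm, hmid⟩
  · have hσe := opp_mul_eq_mul_of_mem (middleSet_subset hmid)
    obtain ⟨z, hz, hzσ⟩ := exists_of_mem_doubleCoset_longestElement hamem
    obtain ⟨p, hp, q, hq, rfl⟩ := h.exists_lower_mul_upper he hz
    rw [hzσ] at hσ0a
    obtain ⟨x', hx', hσx'⟩ := (h.mem_lower_doubleCoset_iff he hp hq).1 hσ0a
    have hei := (h.isIdempotentElem e he).eq
    have hp' := (h.mem_parabolic_lowerTypeMap_iff he).1 hp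
    have hx'' := (h.mem_parabolic_lowerTypeMap_iff he).1 hx'
    have hq' := mul_eq_mul_of_mem_parabolic_typeMap cs
      (parabolic_mono cs (upperTypeMap_subset cs e) hq)
    -- Both units have the form `w₀ x q` with the same `q ∈ W_{λ^*(e)}` and some `x` that `e`
    -- absorbs.
    have key : (σ0 : R) * e = (a * longestElement cs : Rˣ) * e := by
      rw [hσx', hzσ]
      push_cast
      rw [mul_assoc, mul_assoc, hq', ← mul_assoc (x' : R), hx'', mul_assoc, mul_assoc, hq',
        ← mul_assoc (p : R), hp']
    have hb2 := mul_eq_mul_of_mem_parabolic_typeMap cs hb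
    calc (x : R) * e * y = ((x * b : Rˣ) : R) * e * σp := by
          rw [hyb]
          push_cast
          rw [mul_assoc (x : R) b e, hb2]
          simp only [mul_assoc]
      _ = σm * (σ0 * e) * σp := by rw [hxb, key]; push_cast; simp only [mul_assoc]
      _ = σm * (opp cs e * σ0 * e) * σp := by rw [hσe, mul_assoc (σ0 : R), hei]
      _ = _ := by simp only [mul_assoc]
  · exact (greenJ_unit_mul_mul_unit _ _ e).trans hJ.symm

theorem IsRennerCoxeterSystem.eq_opp_of_greenJ (h : IsRennerCoxeterSystem cs Λ) {r em ep : R}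
    (hm : em ∈ oppositeLattice cs Λ) (hp : ep ∈ Λ) (hmr : GreenJ em r) (hrp : GreenJ r ep) :
    em = opp cs ep := by
  obtain ⟨e, he, rfl⟩ := hm
  have := h.eq_of_greenJ he hp (((greenJ_unit_mul_mul_unit _ _ e).symm.trans hmr).trans hrp)
  rw [this, opp]

theorem IsVanillaForm.unique {r : R} {em fm ep fp : R} {σm τm σ0 τ0 σp τp : Rˣ}
    (h : IsRennerCoxeterSystem cs Λ) (hσ : IsVanillaForm cs Λ r σm em σ0 ep σp)
    (hτ : IsVanillaForm cs Λ r τm fm τ0 fp τp) :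
    σm = τm ∧ em = fm ∧ σ0 = τ0 ∧ ep = fp ∧ σp = τp := by
  have hpp : ep = fp := h.eq_of_greenJ hσ.mem_lattice hτ.mem_lattice
    (hσ.greenJ_right.symm.trans hτ.greenJ_right)
  subst hpp
  obtain rfl := h.eq_opp_of_greenJ hσ.mem_oppositeLattice hσ.mem_lattice hσ.greenJ_left
    hσ.greenJ_right
  obtain rfl := h.eq_opp_of_greenJ hτ.mem_oppositeLattice hτ.mem_lattice hτ.greenJ_left
    hτ.greenJ_right
  have he := hσ.mem_lattice
  have hei := h.isIdempotentElem ep he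
  have hσe := opp_mul_eq_mul_of_mem (middleSet_subset hσ.middle_mem)
  have hτe := opp_mul_eq_mul_of_mem (middleSet_subset hτ.middle_mem)
  have hσr : r = ((σm * σ0 : Rˣ) : R) * ep * σp := by
    rw [hσ.eq_prod, mul_assoc (σm : R), hσe, mul_assoc (σm : R), mul_assoc (σ0 : R), hei.eq]
    push_cast
    simp only [mul_assoc]
  have hτr : r = ((τm * τ0 : Rˣ) : R) * ep * τp := by
    rw [hτ.eq_prod, mul_assoc (τm : R), hτe, mul_assoc (τm : R), mul_assoc (τ0 : R), hei.eq]
    push_cast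
    simp only [mul_assoc]
  have hp : σp = τp := by
    have hc := h.factorizable.commute_right_of_eq hei (hσr.symm.trans hτr)
    rw [← h.mem_parabolic_typeMap_iff he] at hc
    exact minReps_unique cs hσ.right_mem hτ.right_mem
      ((mem_doubleCoset_iff cs).2 ⟨_, hc, 1, one_mem _, by group⟩)
  subst hp
  have hr : (σm : R) * opp cs ep * σ0 = τm * opp cs ep * τ0 := by
    have := hσr.symm.trans hτr
    rw [Units.mul_left_inj] at this
    rw [mul_assoc, hσe, mul_assoc, hτe]
    simpa [mul_assoc] using this
  have hoi : IsIdempotentElem (opp cs ep) := by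
    unfold IsIdempotentElem
    rw [← opp_mul, hei.eq]
  have hm : σm = τm := by
    have hc := h.factorizable.commute_left_of_eq hoi hr
    have hmem : σm⁻¹ * τm ∈ parabolic cs (typeMap cs (opp cs ep)) := by
      -- The centralizer is known to be parabolic only for idempotents of `Λ`, so the claim for `e₋`
      -- is transported by `w₀`.
      rw [← longestElement_conj_conj cs (σm⁻¹ * τm)]
      apply conj_mem_parabolic_typeMap
      rw [h.mem_parabolic_typeMap_iff he, val_opp]
      have := congrArg (opp cs) hc
      rwa [opp_mul, opp_mul, opp_opp] at this
    exact minReps_unique cs hσ.left_mem hτ.left_mem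
      ((mem_doubleCoset_iff cs).2 ⟨1, one_mem _, _, hmem, by group⟩)
  subst hm
  have h0 : σ0 = τ0 := by
    have h1 : (σ0 : R) * ep = τ0 * ep := by
      rw [← hσe, ← hτe]
      simpa [mul_assoc] using hr
    have hmem : σ0⁻¹ * τ0 ∈ parabolic cs (lowerTypeMap cs ep) := by
      rw [h.mem_parabolic_lowerTypeMap_iff he]
      push_cast
      rw [mul_assoc, ← h1, Units.inv_mul_cancel_left]
    exact minReps_unique cs hσ.middle_mem.1 hτ.middle_mem.1
      ((mem_doubleCoset_iff cs).2 ⟨1, one_mem _, _, hmem, by group⟩)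
  exact ⟨rfl, rfl, h0, rfl, rfl⟩

/-- The elements `w₀ d b` with `w₀ d` the minimum of `w₀ W_{λ_*(e)}` and `b ∈ W_{λ^*(e)}` are
minimum double coset representatives. -/
theorem IsRennerCoxeterSystem.mul_upper_mem_minReps (h : IsRennerCoxeterSystem cs Λ) {e : R}
    (he : e ∈ Λ) {d b : Rˣ} (hd : d ∈ parabolic cs (lowerTypeMap cs e))
    (hb : b ∈ parabolic cs (upperTypeMap cs e))
    (hm : longestElement cs * d ∈
      minReps cs (lowerTypeMap cs (opp cs e)) (lowerTypeMap cs e)) :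
    longestElement cs * (d * b) ∈
      minReps cs (lowerTypeMap cs (opp cs e)) (lowerTypeMap cs e) := by
  refine mem_minReps_of_length_minimal cs fun v hv => ?_
  -- Since `ℓ(w₀ x b) = ℓ(w₀) - ℓ(b) - ℓ(x)`, comparing `x` with `d` does not involve `b`; the case
  -- `b = 1` is `hm`.
  obtain ⟨x, hx, rfl⟩ := (h.mem_lower_doubleCoset_iff he hd hb).1 hv
  have hlen : ∀ z ∈ parabolic cs (lowerTypeMap cs e),
      cs.length (longestElement cs * (z * b)) + (cs.length b + cs.length z) =
        cs.length (longestElement cs) := by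
    intro z hz
    rw [(h.commute_lower_upper he hz hb).eq, ← h.length_upper_mul_lower he hb hz,
      length_longestElement_mul_add]
  have hle := (hm (longestElement cs * x) (by
    have := (h.mem_lower_doubleCoset_iff he hd (one_mem _)
      (v := longestElement cs * (x * 1))).2 ⟨x, hx, rfl⟩
    simpa using this)).length_le
  have h1 := hlen d hd
  have h2 := hlen x hx
  have h3 := length_longestElement_mul_add cs d
  have h4 := length_longestElement_mul_add cs x
  omega

theorem IsRennerCoxeterSystem.exists_lower_of_mem_minRepsOf (h : IsRennerCoxeterSystem cs Λ)
    {e : R} (he : e ∈ Λ) {m : Rˣ}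
    (hm : m ∈ doubleCoset cs (lowerTypeMap cs (opp cs e)) (lowerTypeMap cs e)
      (longestElement cs)) :
    ∃ d ∈ parabolic cs (lowerTypeMap cs e), m = longestElement cs * d := by
  obtain ⟨d, hd, hmd⟩ := (h.mem_lower_doubleCoset_iff he (y := 1) (b := 1) (v := m)
    (one_mem _) (one_mem _)).1 (by simpa using hm)
  exact ⟨d, hd, by simpa using hmd⟩

/-- Both sides are `w₀ d W_{λ^*(e)}`, where `w₀ d` is the minimum for `w₀`: conjugation by `w₀`
turns the left factor into an element of `W_{λ^*(e)}`, which commutes with `d`. -/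
theorem IsRennerCoxeterSystem.middleSet_eq (h : IsRennerCoxeterSystem cs Λ) {e : R}
    (he : e ∈ Λ) :
    (parabolic cs (upperTypeMap cs (opp cs e)) : Set Rˣ) *
        minRepsOf cs (lowerTypeMap cs (opp cs e)) (lowerTypeMap cs e) {longestElement cs} *
        (parabolic cs (upperTypeMap cs e) : Set Rˣ) =
      middleSet cs (opp cs e) e := by
  ext u
  constructor
  · rintro ⟨_, ⟨a, ha, m, ⟨hm, _, rfl, hmd⟩, rfl⟩, b, hb, rfl⟩
    obtain ⟨d, hd, rfl⟩ := h.exists_lower_of_mem_minRepsOf he hmd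
    have ha' := conj_mem_parabolic_upperTypeMap cs ha
    rw [opp_opp] at ha'
    have hb' := MulMemClass.mul_mem ha' hb
    have hprod : a * (longestElement cs * d) * b =
        longestElement cs * (d * (longestElement cs * a * longestElement cs * b)) := by
      rw [← mul_assoc d, (h.commute_lower_upper he hd ha').eq, ← mul_assoc, ← mul_assoc,
        ← mul_assoc, longestElement_mul_conj, mul_assoc, mul_assoc]
    change a * (longestElement cs * d) * b ∈ _
    rw [hprod]
    refine ⟨h.mul_upper_mem_minReps he hd hb' hm, _, longestElement_mul_mem
      (MulMemClass.mul_mem (parabolic_mono cs (lowerTypeMap_subset cs e) hd)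
        (parabolic_mono cs (upperTypeMap_subset cs e) hb')), mem_doubleCoset_self cs _ _ _⟩
  · intro hu
    obtain ⟨z, hz, rfl⟩ := exists_of_mem_doubleCoset_longestElement (middleSet_subset hu)
    obtain ⟨y, hy, b, hb, rfl⟩ := h.exists_lower_mul_upper he hz
    obtain ⟨m, hm, hmd⟩ := exists_minReps cs (lowerTypeMap cs (opp cs e)) (lowerTypeMap cs e)
      (longestElement cs)
    obtain ⟨d, hd, rfl⟩ := h.exists_lower_of_mem_minRepsOf he hmd
    have hdb := h.mul_upper_mem_minReps he hd hb hm
    have heq : longestElement cs * (y * b) = longestElement cs * (d * b) :=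
      minReps_unique cs hu.1 hdb ((h.mem_lower_doubleCoset_iff he hy hb).2 ⟨d, hd, rfl⟩)
    rw [heq, ← mul_assoc]
    -- The right-hand factor alone suffices, so the left one is taken to be 1.
    exact Set.mul_mem_mul ⟨1, one_mem _, _, ⟨hm, _, rfl, hmd⟩, one_mul _⟩ hb

end Vanilla

end RennerCoxeter

theorem mainTheorem6 {R : Type*} [Monoid R] [Finite R] {B : Type*} {M : CoxeterMatrix B}
    (cs : CoxeterSystem M Rˣ) (Λ : Set R)
    (hR : RennerCoxeter.IsRennerCoxeterSystem cs Λ) (r : R) :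
    (∃! t : Rˣ × R × Rˣ × R × Rˣ,
      RennerCoxeter.IsVanillaForm cs Λ r t.1 t.2.1 t.2.2.1 t.2.2.2.1 t.2.2.2.2) ∧
    ∀ em ∈ RennerCoxeter.oppositeLattice cs Λ, ∀ ep ∈ Λ,
      RennerCoxeter.GreenJ em r → RennerCoxeter.GreenJ r ep →
      (RennerCoxeter.parabolic cs (RennerCoxeter.upperTypeMap cs em) : Set Rˣ) *
          RennerCoxeter.minRepsOf cs (RennerCoxeter.lowerTypeMap cs em)
            (RennerCoxeter.lowerTypeMap cs ep) {RennerCoxeter.longestElement cs} *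
          (RennerCoxeter.parabolic cs (RennerCoxeter.upperTypeMap cs ep) : Set Rˣ) =
        RennerCoxeter.middleSet cs em ep := by
  constructor
  · obtain ⟨e, -, σm, σ0, σp, hσ⟩ := hR.exists_vanillaForm r
    refine ⟨(σm, RennerCoxeter.opp cs e, σ0, e, σp), hσ, ?_⟩
    rintro ⟨τm, fm, τ0, fp, τp⟩ hτ
    obtain ⟨rfl, rfl, rfl, rfl, rfl⟩ := RennerCoxeter.IsVanillaForm.unique hR hσ hτ
    rfl
  · intro em hem ep hep h1 h2
    obtain rfl := hR.eq_opp_of_greenJ hem hep h1 h2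
    exact hR.middleSet_eq hep
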